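/- **Setting.** Let $m\ge 1$, let $F=(f_1,\dots,f_m):\mathbb{R}^n\to\mathbb{R}^m$ be continuously differentiable and let $\Omega=[l,u]\subseteq\mathbb{R}^n$ be a box whose bounds may be infinite. For $a,b\in\mathbb{R}^m$, $a\le b$ is meant componentwise, and $a\lneqq b$ means $a\le b$ and $a\ne b$. A set $X$ is *mutually nondominated* if there are no $x,y\in X$ with $F(y)\lneqq F(x)$. For $\emptyset\ne I\subseteq\{1,\dots,m\}$ and $x\in\Omega$ let $v^I(x)$ and $\theta^I(x)$ be the minimizer and the minimum of $$\max_{j\in I}\nabla f_j(x)^\top d+\tfrac12\|d\|^2\quad\text{over } d\in\mathbb{R}^n \text{ with } x+d\in\Omega .$$ Write $v,\theta$ for $I=\{1,\dots,m\}$, $D(x,d)=\max_{j}\nabla f_j(x)^\top d$, and $\Theta(X)=\inf_{x\in X}\theta(x)$. For $\zeta\in\mathbb{R}^m$ let $V_F(X)$ be the Lebesgue measure of $\{w\in\mathbb{R}^m\mid \exists x\in X:\ F(x)\le w\le\zeta\}$; whenever the algorithm below compares values of $V_F$, it takes $\zeta_j=\max f_j$ over all points generated so far (including those of $X^0$). **Algorithm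 FPD_NMT.** Input: a finite mutually nondominated set $X^0\subset\Omega$, $\alpha_0\in(0,1]$, $\delta,\gamma\in(0,1)$, $M\in\mathbb{N}$, and $\sigma_k\ge 0$ for $k=0,1,\dots$ Set $C^{-1}=\emptyset$. Iteration $k=0,1,\dots$ is as follows. 1. Choose $X^{l(k)}\in\operatorname{argmin}\{V_F(X)\mid X\in\{X^k,X^{k-1},\dots,X^{k-\min\{k,M\}}\}\}$, with $k-\min\{k,M\}\le l(k)\le k$. Let $\bar C^k$ be the set of the $x\in X^{l(k)}\cup C^{k-1}$ for which no $y\in X^{l(k)}\cup C^{k-1}$ has $F(y)\lneqq F(x)$. Let $C^k=\bar C^k\cup\{x\in X^k\mid\forall y\in\bar C^k\ \exists j:\ f_j(y)<f_j(x)\}$, and set $\hat X^k=C^k$. 2. Process the points $x_p\in X^k$ one after the other. If some $y\in\hat X^k$ has $F(y)\lneqq F(x_p)$, skip $x_p$. Otherwise do (a), (b) and (c). - (a) If $\theta(x_p)\ge-\sigma_k$, let $\alpha=0$. If $\theta(x_p)<-\sigma_k$, let $\alpha$ be the largest number $a\in\{\alpha_0\delta^h\mid h\in\mathbb{N}\}$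 for which there is $c\in\hat X^k$ with $F(x_p)\le F(c)$ and $F(x_p+a\,v(x_p))\le F(c)+\mathbf 1\gamma a D(x_p,v(x_p))$, provided that some $c\in\hat X^k$ has $F(x_p)\le F(c)$. If no such $c$ exists, let $\alpha$ be the largest such $a$ with $F(x_p+a\,v(x_p))\le F(x_p)+\mathbf 1\gamma a D(x_p,v(x_p))$. - (b) Let $z=x_p+\alpha v(x_p)$, add $z$ to $\hat X^k$, and remove from $\hat X^k$ all $y$ with $F(z)\lneqq F(y)$. - (c) For each nonempty $I\subseteq\{1,\dots,m\}$ with $\theta^I(z)<0$, in any order: if $z$ is still in $\hat X^k$, let $\alpha^I$ be the largest $a\in\{\alpha_0\delta^h\mid h\in\mathbb{N}\}$ such that for every $y\in\hat X^k$ some $j$ has $f_j(z+a\,v^I(z))<f_j(y)$; add $z'=z+\alpha^I v^I(z)$ to $\hat X^k$, and remove from $\hat X^k$ all $y$ with $F(z')\lneqq F(y)$. 3. Choose $\bar X^{l(k)}\in\operatorname{argmin}\{V_F(X)\mid X\in\{\hat X^k\}\cup\{X^k,X^{k-1},\dots,X^{k-\min\{k,M-1\}}\}\}$ (the second family being empty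 for $M=0$). Let $X^{k+1}$ be the set of the $x\in\hat X^k\cup\bar X^{l(k)}$ for which no $y\in\hat X^k\cup\bar X^{l(k)}$ has $F(y)\lneqq F(x)$. **Theorem.** Let $\{X^k\}$ be the sequence produced by an infinite run of FPD_NMT from a mutually nondominated set $X^0$. Suppose that * in every iteration $k$ the first point processed in step 2 belongs to $\operatorname{argmin}_{x\in X^k}\theta(x)$ (Assumption 1); * $\bar X^{l(k-1)}=X^{l(k)}$ for all $k>0$ (Assumption 2); * for some $x_0\in X^0$ the set $\mathcal L(x_0)=\bigcup_{j=1}^m\{x\in\Omega\mid f_j(x)\le f_j(x_0)\}$ is compact. Then there is an infinite set $K\subseteq\{0,1,\dots\}$ such that (i) if $\sigma_k=\sigma>0$ for all $k$, there is $\bar k\in K$ with $\Theta(X^k)\ge-\sigma$ for all $k\in K$ with $k\ge\bar k$; (ii) if $\sigma_k\to0$, then $\lim_{k\in K,\,k\to\infty}\Theta(X^k)=0$. -/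

import Mathlib

open Set Filter Topology MeasureTheory
open scoped ENNReal

namespace FPDNMT

noncomputable section

/-- The decision space `ℝⁿ` with its Euclidean norm. -/
abbrev Pt (n : ℕ) : Type := EuclideanSpace ℝ (Fin n)

/-- The (possibly infinite) box `[l, u]`. -/
def box {n : ℕ} (l u : Fin n → EReal) : Set (Pt n) :=
  {x | ∀ i, l i ≤ (x i : EReal) ∧ (x i : EReal) ≤ u i}

/- Vectors of objective values live in `Fin m → ℝ` with the componentwise order: there `a ≤ b` is
`≤` in every component, and `a < b` is `a ≤ b ∧ a ≠ b`, the relation used for dominance. -/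

/-- `x` is not dominated by any point of `S` w.r.t. `F`. -/
def NotDominatedBy {n m : ℕ} (F : Pt n → Fin m → ℝ) (S : Set (Pt n)) (x : Pt n) : Prop :=
  ¬ ∃ y ∈ S, F y < F x

/-- The points of `S` are mutually nondominated w.r.t. `F`. -/
def MutuallyNondominated {n m : ℕ} (F : Pt n → Fin m → ℝ) (S : Set (Pt n)) : Prop :=
  ∀ x ∈ S, NotDominatedBy F S x

/-- The nondominated points of `S`. -/
def nondominated {n m : ℕ} (F : Pt n → Fin m → ℝ) (S : Set (Pt n)) : Set (Pt n) :=
  {x ∈ S | NotDominatedBy F S x}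

/-! ### Projected directions -/

/-- `max_{j ∈ I} ∇ f_j(x)ᵀ d` (used for nonempty `I`). -/
def maxSlope {n m : ℕ} (F : Pt n → Fin m → ℝ) (I : Finset (Fin m)) (x d : Pt n) : ℝ :=
  ⨆ j : {j // j ∈ I}, fderiv ℝ (fun y => F y j) x d

/-- `max_{j ∈ I} ∇ f_j(x)ᵀ d + ½ ‖d‖²`. -/
def dirObjective {n m : ℕ} (F : Pt n → Fin m → ℝ) (I : Finset (Fin m)) (x d : Pt n) : ℝ :=
  maxSlope F I x d + 1 / 2 * ‖d‖ ^ 2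

/-- `d` minimizes `dirObjective F I x` over the `d` with `x + d ∈ Ω`. -/
def IsProjectedDirection {n m : ℕ} (F : Pt n → Fin m → ℝ) (Ω : Set (Pt n))
    (I : Finset (Fin m)) (x d : Pt n) : Prop :=
  x + d ∈ Ω ∧ ∀ d', x + d' ∈ Ω → dirObjective F I x d ≤ dirObjective F I x d'

/-- The projected partial descent direction `v^I(x)`. -/
def vI {n m : ℕ} (F : Pt n → Fin m → ℝ) (Ω : Set (Pt n)) (I : Finset (Fin m)) (x : Pt n) : Pt n :=
  Classical.epsilon (IsProjectedDirection F Ω I x)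

/-- The optimal value `θ^I(x)`. -/
def thetaI {n m : ℕ} (F : Pt n → Fin m → ℝ) (Ω : Set (Pt n)) (I : Finset (Fin m)) (x : Pt n) : ℝ :=
  sInf (dirObjective F I x '' {d | x + d ∈ Ω})

/-- The projected common descent direction `v(x)`. -/
def v {n m : ℕ} (F : Pt n → Fin m → ℝ) (Ω : Set (Pt n)) (x : Pt n) : Pt n :=
  vI F Ω Finset.univ x

/-- The optimal value `θ(x)`. -/
def theta {n m : ℕ} (F : Pt n → Fin m → ℝ) (Ω : Set (Pt n)) (x : Pt n) : ℝ :=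
  thetaI F Ω Finset.univ x

/-- `D(x, d) = max_j ∇ f_j(x)ᵀ d`. -/
def D {n m : ℕ} (F : Pt n → Fin m → ℝ) (x d : Pt n) : ℝ :=
  maxSlope F Finset.univ x d

/-- `Θ(X) = inf_{x ∈ X} θ(x)`. -/
def Theta {n m : ℕ} (F : Pt n → Fin m → ℝ) (Ω : Set (Pt n)) (X : Set (Pt n)) : ℝ :=
  sInf (theta F Ω '' X)

/-! ### Hyper-volume -/

/-- The region dominated by `Y` up to the reference point `ζ`. -/
def dominatedRegion {m : ℕ} (ζ : Fin m → ℝ) (Y : Set (Fin m → ℝ)) : Set (Fin m → ℝ) :=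
  {y | ∃ y' ∈ Y, y' ≤ y ∧ y ≤ ζ}

/-- The hyper-volume `V_F(X)` of the image of `X`, with reference point `ζ`. -/
def hyperVolume {n m : ℕ} (F : Pt n → Fin m → ℝ) (ζ : Fin m → ℝ) (X : Set (Pt n)) : ℝ≥0∞ :=
  volume (dominatedRegion ζ (F '' X))

/-- The reference point with components `max_{x ∈ A} f_j(x)` (used for finite nonempty `A`). -/
def refPoint {n m : ℕ} (F : Pt n → Fin m → ℝ) (A : Set (Pt n)) : Fin m → ℝ :=
  fun j => sSup ((fun x => F x j) '' A)

/-! ### The algorithm -/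

/-- The parameters of the algorithm. -/
structure Params where
  /-- initial step size of the line searches -/
  α₀ : ℝ
  /-- backtracking factor -/
  δ : ℝ
  /-- sufficient decrease factor -/
  γ : ℝ
  /-- memory length -/
  M : ℕ
  /-- stationarity tolerances -/
  σ : ℕ → ℝ

/-- What the inner loops update: the current set `X̂` and the set of all points generated so far. -/
structure State (n : ℕ) where
  /-- the current set `X̂` -/
  Xhat : Set (Pt n)
  /-- all points generated so far -/
  Xall : Set (Pt n)

/-- Add the new point `z` to `X̂` and remove from `X̂` the points that `z` dominates. -/
def State.add {n m : ℕ} (F : Pt n → Fin m → ℝ) (s : State n) (z : Pt n) : State n where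
  Xhat := (s.Xhat ∪ {z}) \ {y ∈ s.Xhat | F z < F y}
  Xall := s.Xall ∪ {z}

/-- `α` is the largest number of the form `α₀ δ ^ h`, `h ∈ ℕ`, that satisfies `P`. -/
def IsLineSearchStep (p : Params) (P : ℝ → Prop) (α : ℝ) : Prop :=
  IsGreatest {a | (∃ h : ℕ, a = p.α₀ * p.δ ^ h) ∧ P a} α

/-- `α` is the step size of the refinement phase at the point `x`, with tolerance `σ` and current
set `Xhat`: nonmonotone line search if some `c ∈ Xhat` has `F x ≤ F c`, Armijo line search
otherwise, and `0` if `θ(x) ≥ -σ`. -/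
def IsRefineStep {n m : ℕ} (F : Pt n → Fin m → ℝ) (Ω : Set (Pt n)) (p : Params) (σ : ℝ)
    (Xhat : Set (Pt n)) (x : Pt n) (α : ℝ) : Prop :=
  (theta F Ω x < -σ →
    ((∃ c ∈ Xhat, F x ≤ F c) →
      IsLineSearchStep p (fun a => ∃ c ∈ Xhat, F x ≤ F c ∧
        ∀ j, F (x + a • v F Ω x) j ≤ F c j + p.γ * a * D F x (v F Ω x)) α) ∧
    ((¬ ∃ c ∈ Xhat, F x ≤ F c) →
      IsLineSearchStep p (fun a =>
        ∀ j, F (x + a • v F Ω x) j ≤ F x j + p.γ * a * D F x (v F Ω x)) α)) ∧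
  (¬ theta F Ω x < -σ → α = 0)

/-- `Explore F Ω p z Is s t`: the second phase from the point `z`, going through the index sets of
the list `Is` in this order, leads from the state `s` to the state `t`. -/
inductive Explore {n m : ℕ} (F : Pt n → Fin m → ℝ) (Ω : Set (Pt n)) (p : Params) (z : Pt n) :
    List (Finset (Fin m)) → State n → State n → Prop
  | done (s : State n) : Explore F Ω p z [] s s
  | skip (I : Finset (Fin m)) (Is : List (Finset (Fin m))) (s t : State n)
      (hz : z ∉ s.Xhat) (h : Explore F Ω p z Is s t) : Explore F Ω p z (I :: Is) s t
  | step (I : Finset (Fin m)) (Is : List (Finset (Fin m))) (s t : State n) (α : ℝ)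
      (hz : z ∈ s.Xhat)
      (hα : IsLineSearchStep p
        (fun a => ∀ y ∈ s.Xhat, ∃ j, F (z + a • vI F Ω I z) j < F y j) α)
      (h : Explore F Ω p z Is (s.add F (z + α • vI F Ω I z)) t) :
      Explore F Ω p z (I :: Is) s t

/-- Processing the point `x` leads from the state `s` to the state `t`. The nonempty index sets `I`
with `θ^I(z) < 0` are visited once each, in any order. -/
def ProcessPoint {n m : ℕ} (F : Pt n → Fin m → ℝ) (Ω : Set (Pt n)) (p : Params) (σ : ℝ)
    (x : Pt n) (s t : State n) : Prop :=
  (¬ NotDominatedBy F s.Xhat x ∧ t = s) ∨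
  (NotDominatedBy F s.Xhat x ∧
    ∃ (α : ℝ) (z : Pt n) (Is : List (Finset (Fin m))),
      IsRefineStep F Ω p σ s.Xhat x α ∧ z = x + α • v F Ω x ∧
      Is.Nodup ∧ (∀ I, I ∈ Is ↔ I.Nonempty ∧ thetaI F Ω I z < 0) ∧
      Explore F Ω p z Is (s.add F z) t)

/-- Processing the points of a list one after the other leads from one state to another. -/
inductive ProcessList {n m : ℕ} (F : Pt n → Fin m → ℝ) (Ω : Set (Pt n)) (p : Params) (σ : ℝ) :
    List (Pt n) → State n → State n → Prop
  | nil (s : State n) : ProcessList F Ω p σ [] s s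
  | cons (x : Pt n) (xs : List (Pt n)) (s s' t : State n)
      (hx : ProcessPoint F Ω p σ x s s') (h : ProcessList F Ω p σ xs s' t) :
      ProcessList F Ω p σ (x :: xs) s t

/-- The set `C̄` built from the selected set `Xl` and the previous reference set `Cprev`. -/
def refSetBar {n m : ℕ} (F : Pt n → Fin m → ℝ) (Xl Cprev : Set (Pt n)) : Set (Pt n) :=
  nondominated F (Xl ∪ Cprev)

/-- The new reference set: `C̄` and the points of `X` that are strictly worse than each point of `C̄`
in at least one objective. -/
def refSet {n m : ℕ} (F : Pt n → Fin m → ℝ) (Xl Cprev X : Set (Pt n)) : Set (Pt n) :=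
  refSetBar F Xl Cprev ∪ {x ∈ X | ∀ y ∈ refSetBar F Xl Cprev, ∃ j, F y j < F x j}

/-- `C^{k-1}`, with `C^{-1} = ∅`. -/
def prevC {n : ℕ} (C : ℕ → Set (Pt n)) : ℕ → Set (Pt n)
  | 0 => ∅
  | k + 1 => C k

/-- An infinite run of the nonmonotone front projected descent algorithm started at `X0`. -/
structure Run {n m : ℕ} (F : Pt n → Fin m → ℝ) (Ω : Set (Pt n)) (p : Params)
    (X0 : Set (Pt n)) where
  /-- the iterates `X^k` -/
  X : ℕ → Set (Pt n)
  /-- the reference sets `C^k` -/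
  C : ℕ → Set (Pt n)
  /-- `X̂^k` at the end of the loop over the points of `X^k` -/
  Xhat : ℕ → Set (Pt n)
  /-- all points generated before iteration `k`, including those of `X^0` -/
  Xall : ℕ → Set (Pt n)
  /-- the index `l(k)` -/
  l : ℕ → ℕ
  /-- the set `X̄^{l(k)}` -/
  Xbar : ℕ → Set (Pt n)
  /-- the order in which the points of `X^k` are processed -/
  order : ℕ → List (Pt n)
  X_zero : X 0 = X0
  Xall_zero : Xall 0 = X0
  /-- `l(k)` is among `k, k - 1, …, k - min {k, M}` -/
  l_mem : ∀ k, l k ≤ k ∧ k ≤ l k + p.M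
  /-- `X^{l(k)}` has the least hyper-volume among these sets -/
  l_min : ∀ k i, i ≤ k → k ≤ i + p.M →
    hyperVolume F (refPoint F (Xall k)) (X (l k)) ≤ hyperVolume F (refPoint F (Xall k)) (X i)
  C_eq : ∀ k, C k = refSet F (X (l k)) (prevC C k) (X k)
  order_nodup : ∀ k, (order k).Nodup
  mem_order : ∀ k x, x ∈ order k ↔ x ∈ X k
  /-- the loop starts with `X̂^k = C^k` -/
  loop : ∀ k, ProcessList F Ω p (p.σ k) (order k) ⟨C k, Xall k⟩ ⟨Xhat k, Xall (k + 1)⟩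
  /-- `X̄^{l(k)}` is `X̂^k` or one of `X^k, X^{k-1}, …, X^{k - min {k, M - 1}}` (the last list being
  empty for `M = 0`) -/
  Xbar_mem : ∀ k, Xbar k = Xhat k ∨ ∃ i, i ≤ k ∧ k + 1 ≤ i + p.M ∧ Xbar k = X i
  /-- `X̄^{l(k)}` has the least hyper-volume among these sets -/
  Xbar_min_hat : ∀ k, hyperVolume F (refPoint F (Xall (k + 1))) (Xbar k) ≤
    hyperVolume F (refPoint F (Xall (k + 1))) (Xhat k)
  Xbar_min : ∀ k i, i ≤ k → k + 1 ≤ i + p.M →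
    hyperVolume F (refPoint F (Xall (k + 1))) (Xbar k) ≤
      hyperVolume F (refPoint F (Xall (k + 1))) (X i)
  X_succ : ∀ k, X (k + 1) = nondominated F (Xhat k ∪ Xbar k)

/-- In every iteration the first point that is processed minimizes `θ` over `X^k`. -/
def Run.FirstLeastStationary {n m : ℕ} {F : Pt n → Fin m → ℝ} {Ω : Set (Pt n)} {p : Params}
    {X0 : Set (Pt n)} (R : Run F Ω p X0) : Prop :=
  ∀ k, ∀ x ∈ (R.order k).head?, ∀ y ∈ R.X k, theta F Ω x ≤ theta F Ω y

/-- For every `k > 0` the sets `X̄^{l(k-1)}` and `X^{l(k)}` are equal. -/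
def Run.SameWorstSet {n m : ℕ} {F : Pt n → Fin m → ℝ} {Ω : Set (Pt n)} {p : Params}
    {X0 : Set (Pt n)} (R : Run F Ω p X0) : Prop :=
  ∀ k, R.Xbar k = R.X (R.l (k + 1))

/-- `𝓛(x₀) = ⋃_j {x ∈ Ω | f_j(x) ≤ f_j(x₀)}`. -/
def levelSet {n m : ℕ} (F : Pt n → Fin m → ℝ) (Ω : Set (Pt n)) (x₀ : Pt n) : Set (Pt n) :=
  ⋃ j : Fin m, {x ∈ Ω | F x j ≤ F x₀ j}

end

end FPDNMT

namespace FPDNMT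

/-! ### The box -/

/-! The hyper-volume acts as a nonmonotone merit function: iterates that stay away from stationarity
would make it grow without bound, although all generated points lie in one compact set.

Suppose `Θ(X^k) < -ε` for all large `k`, with tolerances at most `ε`. The first processed point `x`
then has `θ(x) < -ε`. It is not dominated by `C^k`, so it is not skipped, and some `c ∈ C^k`
satisfies `F x ≤ F c`, so the nonmonotone search applies to it. Armijo decrease at `x` implies the
nonmonotone condition, and by compactness it holds for all small steps uniformly in `x`
(`exists_uniform_armijo_step`). The new point thus improves some `c ∈ C^k` by a fixed `η` in every
objective. Since `C^k` is mutually nondominated, the box between the two images is not yet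
dominated, so the volume grows by at least `η ^ m` (`hyperVolume_add_le`,
`Run.Invariant.hyperVolume_gain`).

The gain is relative to `X^{l(k)}`, which `C^k` covers. The volume of `X^{l(k)}` never decreases,
and within `M + 1` iterations the memory window contains only newer sets, so it gains a fixed amount
every `M + 1` iterations. It is bounded by the volume of a box around the image of the level set, a
contradiction (`Run.exists_neg_le_Theta`).

Assumption 2 keeps `X^k` undominated by `X^{l(k)} ∪ C^{k-1}`, on which the properties of `C^k` rest
(`Run.Invariant.succ`). -/

lemma isClosed_box {n : ℕ} (l u : Fin n → EReal) : IsClosed (box l u) := by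
  have hc : ∀ i : Fin n, Continuous fun x : Pt n => ((x i : ℝ) : EReal) := fun i =>
    continuous_coe_real_ereal.comp (by fun_prop)
  have h : box l u = ⋂ i, {x : Pt n | l i ≤ (x i : EReal)} ∩ {x | (x i : EReal) ≤ u i} := by
    ext x
    simp [box]
  rw [h]
  exact isClosed_iInter fun i =>
    (isClosed_le continuous_const (hc i)).inter (isClosed_le (hc i) continuous_const)

lemma convex_box {n : ℕ} (l u : Fin n → EReal) : Convex ℝ (box l u) := by
  intro x hx y hy a b ha hb hab i
  have hord : OrdConnected {r : ℝ | l i ≤ (r : EReal) ∧ (r : EReal) ≤ u i} :=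
    ⟨fun r hr s hs t ht => ⟨hr.1.trans (EReal.coe_le_coe_iff.2 ht.1),
      (EReal.coe_le_coe_iff.2 ht.2).trans hs.2⟩⟩
  have := hord.convex (𝕜 := ℝ) (hx i) (hy i) ha hb hab
  simpa using this

lemma add_smul_mem_of_convex {n : ℕ} {Ω : Set (Pt n)} (hΩ : Convex ℝ Ω) {x d : Pt n} (hx : x ∈ Ω)
    (hd : x + d ∈ Ω) {a : ℝ} (ha₀ : 0 ≤ a) (ha₁ : a ≤ 1) : x + a • d ∈ Ω :=
  hΩ.add_smul_mem hx hd ⟨ha₀, ha₁⟩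

/-! ### Projected directions -/

section Directions

variable {n m : ℕ} {F : Pt n → Fin m → ℝ} {Ω : Set (Pt n)} {I : Finset (Fin m)}

lemma le_maxSlope (F : Pt n → Fin m → ℝ) {j : Fin m} (hj : j ∈ I) (x d : Pt n) :
    fderiv ℝ (fun y => F y j) x d ≤ maxSlope F I x d :=
  le_ciSup (f := fun j : {j // j ∈ I} => fderiv ℝ (fun y => F y j) x d)
    (Set.finite_range _).bddAbove ⟨j, hj⟩

lemma maxSlope_zero (F : Pt n → Fin m → ℝ) (I : Finset (Fin m)) (x : Pt n) :
    maxSlope F I x 0 = 0 := by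
  simp [maxSlope]

lemma dirObjective_zero (F : Pt n → Fin m → ℝ) (I : Finset (Fin m)) (x : Pt n) :
    dirObjective F I x 0 = 0 := by
  simp [dirObjective, maxSlope_zero]

lemma continuous_maxSlope (F : Pt n → Fin m → ℝ) (hI : I.Nonempty) (x : Pt n) :
    Continuous (maxSlope F I x) := by
  have : Nonempty {j // j ∈ I} := hI.to_subtype
  have h : maxSlope F I x = fun d => Finset.univ.sup' Finset.univ_nonempty
      (fun j : {j // j ∈ I} => fderiv ℝ (fun y => F y j) x d) := by
    funext d
    rw [Finset.sup'_univ_eq_ciSup]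
    rfl
  rw [h]
  exact Continuous.finset_sup'_apply _ fun j _ => ContinuousLinearMap.continuous _

/-- The quadratic term beats any one slope: once `‖d‖` is at least twice the norm of the derivative
of some `f_j`, `j ∈ I`, the objective is at least its value `0` at `d = 0`. Existence makes the
`epsilon` choice in `vI` a true minimizer. -/
lemma exists_isProjectedDirection (F : Pt n → Fin m → ℝ) (hΩ : IsClosed Ω) (hI : I.Nonempty)
    {x : Pt n} (hx : x ∈ Ω) : ∃ d, IsProjectedDirection F Ω I x d := by
  obtain ⟨j, hj⟩ := hI
  have hcl : IsClosed {d : Pt n | x + d ∈ Ω} := hΩ.preimage (by fun_prop)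
  have hcont : Continuous (dirObjective F I x) := by
    have := continuous_maxSlope F ⟨j, hj⟩ x
    unfold dirObjective
    fun_prop
  have hev : ∀ᶠ d in cocompact (Pt n) ⊓ 𝓟 {d : Pt n | x + d ∈ Ω},
      dirObjective F I x 0 ≤ dirObjective F I x d := by
    apply Filter.Eventually.filter_mono inf_le_left
    have hn := (tendsto_norm_cocompact_atTop (E := Pt n)).eventually_ge_atTop
      (2 * ‖fderiv ℝ (fun y => F y j) x‖)
    filter_upwards [hn] with d hd
    rw [dirObjective_zero]
    have h1 := le_maxSlope F hj x d
    have h2 := (fderiv ℝ (fun y => F y j) x).le_opNorm d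
    have h3 := neg_abs_le (fderiv ℝ (fun y => F y j) x d)
    rw [Real.norm_eq_abs] at h2
    unfold dirObjective
    nlinarith [norm_nonneg d]
  obtain ⟨d, hd, hmin⟩ := hcont.continuousOn.exists_isMinOn' hcl
    (show (0 : Pt n) ∈ {d : Pt n | x + d ∈ Ω} by simpa using hx) hev
  exact ⟨d, hd, fun d' hd' => hmin hd'⟩

lemma isProjectedDirection_vI (F : Pt n → Fin m → ℝ) (hΩ : IsClosed Ω) (hI : I.Nonempty)
    {x : Pt n} (hx : x ∈ Ω) : IsProjectedDirection F Ω I x (vI F Ω I x) :=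
  Classical.epsilon_spec (exists_isProjectedDirection F hΩ hI hx)

lemma thetaI_eq (F : Pt n → Fin m → ℝ) (hΩ : IsClosed Ω) (hI : I.Nonempty)
    {x : Pt n} (hx : x ∈ Ω) : thetaI F Ω I x = dirObjective F I x (vI F Ω I x) := by
  have h := isProjectedDirection_vI F hΩ hI hx
  refine IsLeast.csInf_eq ⟨⟨_, h.1, rfl⟩, ?_⟩
  rintro _ ⟨d, hd, rfl⟩
  exact h.2 d hd

variable [NeZero m]

lemma theta_eq (F : Pt n → Fin m → ℝ) (hΩ : IsClosed Ω) {x : Pt n} (hx : x ∈ Ω) :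
    theta F Ω x = D F x (v F Ω x) + 1 / 2 * ‖v F Ω x‖ ^ 2 :=
  thetaI_eq F hΩ Finset.univ_nonempty hx

lemma add_v_mem (F : Pt n → Fin m → ℝ) (hΩ : IsClosed Ω) {x : Pt n} (hx : x ∈ Ω) :
    x + v F Ω x ∈ Ω :=
  (isProjectedDirection_vI F hΩ Finset.univ_nonempty hx).1

lemma theta_nonpos (F : Pt n → Fin m → ℝ) (hΩ : IsClosed Ω) {x : Pt n} (hx : x ∈ Ω) :
    theta F Ω x ≤ 0 := by
  have h := (isProjectedDirection_vI F hΩ Finset.univ_nonempty hx).2 0 (by simpa using hx)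
  rw [dirObjective_zero, ← thetaI_eq F hΩ Finset.univ_nonempty hx] at h
  exact h

lemma D_v_le_theta (F : Pt n → Fin m → ℝ) (hΩ : IsClosed Ω) {x : Pt n} (hx : x ∈ Ω) :
    D F x (v F Ω x) ≤ theta F Ω x := by
  rw [theta_eq F hΩ hx]
  nlinarith [sq_nonneg ‖v F Ω x‖]

lemma Theta_nonpos (F : Pt n → Fin m → ℝ) (hΩ : IsClosed Ω) {S : Set (Pt n)} (hS : S ⊆ Ω) :
    Theta F Ω S ≤ 0 :=
  Real.sInf_nonpos (by rintro _ ⟨x, hx, rfl⟩; exact theta_nonpos F hΩ (hS hx))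

/-- The norm of the projected direction is at most twice the norm of the derivative. -/
lemma norm_v_le (hF : Differentiable ℝ F) (hΩ : IsClosed Ω) {x : Pt n} (hx : x ∈ Ω) :
    ‖v F Ω x‖ ≤ 2 * ‖fderiv ℝ F x‖ := by
  set d := v F Ω x with hd
  have h1 := theta_nonpos F hΩ hx
  rw [theta_eq F hΩ hx, ← hd] at h1
  have h2 : fderiv ℝ (fun y => F y 0) x d ≤ D F x d := le_maxSlope F (Finset.mem_univ 0) x d
  rw [fderiv_apply (hF x) 0] at h2
  have h3 : |fderiv ℝ F x d 0| ≤ ‖fderiv ℝ F x‖ * ‖d‖ :=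
    (norm_le_pi_norm (fderiv ℝ F x d) 0).trans ((fderiv ℝ F x).le_opNorm d)
  have h4 := neg_abs_le (fderiv ℝ F x d 0)
  have h5 : fderiv ℝ F x d 0 ≤ D F x d := by simpa using h2
  by_contra! hlt
  have h6 : 0 < ‖d‖ := lt_of_le_of_lt (by positivity) hlt
  nlinarith

/-- The Armijo condition holds for all small steps, uniformly over the points of a compact set
that are not almost stationary. -/
lemma exists_uniform_armijo_step (hF : ContDiff ℝ 1 F) (hΩ : IsClosed Ω) {L : Set (Pt n)}
    (hL : IsCompact L) (hLΩ : L ⊆ Ω) {γ ε : ℝ} (hγ : γ < 1) (hε : 0 < ε) :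
    ∃ ρ > 0, ∀ x ∈ L, theta F Ω x < -ε → ∀ a, 0 < a → a ≤ ρ →
      ∀ j, F (x + a • v F Ω x) j ≤ F x j + γ * a * D F x (v F Ω x) := by
  have hdiff : Differentiable ℝ F := hF.differentiable one_ne_zero
  have hcont : Continuous (fderiv ℝ F) := hF.continuous_fderiv one_ne_zero
  obtain ⟨G, hG⟩ := hL.exists_bound_of_continuousOn hcont.continuousOn
  -- `B` bounds `‖v(x)‖` on `L`. The constant `τ` makes the linearization error per unit step,
  -- `τ‖d‖`, at most `(1 - γ)ε`, the slack between `D` and `γD` when `D < -ε`.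
  set B := 2 * max G 0 + 1 with hB
  have hBpos : 0 < B := by positivity
  set τ := (1 - γ) * ε / B with hτ
  have hγ' : 0 < 1 - γ := by linarith
  have hτpos : 0 < τ := by positivity
  -- Only `x` has to lie in `L`; the segment from `x` to the trial point may leave it.
  have hunif := hL.uniformContinuousAt_of_continuousAt (fderiv ℝ F)
    (fun x _ => hcont.continuousAt) (Metric.dist_mem_uniformity hτpos)
  obtain ⟨r, hr, hunif⟩ := Metric.mem_uniformity_dist.1 hunif
  refine ⟨r / (2 * B), by positivity, fun x hx hθ a ha har j => ?_⟩
  set d := v F Ω x with hd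
  have hdB : ‖d‖ ≤ B := by
    have h1 := norm_v_le hdiff hΩ (hLΩ hx)
    have h2 := hG x hx
    have h3 := le_max_left G 0
    linarith
  have hstep : ‖a • d‖ < r := by
    rw [norm_smul, Real.norm_eq_abs, abs_of_pos ha]
    calc a * ‖d‖ ≤ r / (2 * B) * B := by gcongr
      _ = r / 2 := by field_simp
      _ < r := by linarith
  have hmv := (convex_ball x r).norm_image_sub_le_of_norm_fderiv_le' (𝕜 := ℝ) (f := F)
    (φ := fderiv ℝ F x) (C := τ) (fun y _ => hdiff y)
    (fun y hy => by
      have := hunif (a := x) (b := y) (by rw [dist_comm]; exact hy) hx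
      simp only [Set.mem_ofPred_eq] at this
      rw [dist_comm, dist_eq_norm] at this
      exact this.le)
    (Metric.mem_ball_self hr) (y := x + a • d) (by simpa [Metric.mem_ball] using hstep)
  have hj := (norm_le_pi_norm _ j).trans hmv
  simp only [add_sub_cancel_left, map_smul, Pi.sub_apply, Pi.smul_apply, smul_eq_mul,
    Real.norm_eq_abs, norm_smul, abs_of_pos ha] at hj
  have hj' := (le_abs_self _).trans hj
  have hD : fderiv ℝ F x d j ≤ D F x d := by
    have : fderiv ℝ (fun y => F y j) x d ≤ D F x d := le_maxSlope F (Finset.mem_univ j) x d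
    rw [fderiv_apply (hdiff x) j] at this
    simpa using this
  have hDε : D F x d < -ε := (D_v_le_theta F hΩ (hLΩ hx)).trans_lt hθ
  have h1 : τ * ‖d‖ ≤ (1 - γ) * ε := by
    calc τ * ‖d‖ ≤ τ * B := by gcongr
      _ = (1 - γ) * ε := by rw [hτ]; field_simp
  have h2 : fderiv ℝ F x d j + τ * ‖d‖ ≤ γ * D F x d := by nlinarith
  nlinarith [mul_le_mul_of_nonneg_left h2 ha.le]

end Directions

end FPDNMT

namespace FPDNMT

/-! ### Dominance -/

section Dominance

variable {n m : ℕ} {F : Pt n → Fin m → ℝ}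

/-- Every point of `S` is weakly dominated by a point of `T`. -/
def WeaklyCovers (F : Pt n → Fin m → ℝ) (T S : Set (Pt n)) : Prop :=
  ∀ x ∈ S, ∃ y ∈ T, F y ≤ F x

lemma WeaklyCovers.of_subset {T S : Set (Pt n)} (h : S ⊆ T) : WeaklyCovers F T S :=
  fun x hx => ⟨x, h hx, le_rfl⟩

lemma WeaklyCovers.trans {U T S : Set (Pt n)} (h₁ : WeaklyCovers F U T)
    (h₂ : WeaklyCovers F T S) : WeaklyCovers F U S := fun x hx =>
  let ⟨y, hy, hyx⟩ := h₂ x hx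
  let ⟨z, hz, hzy⟩ := h₁ y hy
  ⟨z, hz, hzy.trans hyx⟩

lemma WeaklyCovers.union {T S S' : Set (Pt n)} (h₁ : WeaklyCovers F T S)
    (h₂ : WeaklyCovers F T S') : WeaklyCovers F T (S ∪ S') := fun x hx =>
  hx.elim (h₁ x) (h₂ x)

lemma NotDominatedBy.mono {S T : Set (Pt n)} {x : Pt n} (h : NotDominatedBy F T x) (hST : S ⊆ T) :
    NotDominatedBy F S x := fun ⟨y, hy, hyx⟩ => h ⟨y, hST hy, hyx⟩

lemma NotDominatedBy.of_weaklyCovers {S T : Set (Pt n)} {x : Pt n} (h : NotDominatedBy F T x)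
    (hST : WeaklyCovers F T S) : NotDominatedBy F S x := fun ⟨y, hy, hyx⟩ =>
  let ⟨z, hz, hzy⟩ := hST y hy
  h ⟨z, hz, hzy.trans_lt hyx⟩

lemma NotDominatedBy.of_le {S : Set (Pt n)} {x z : Pt n} (h : NotDominatedBy F S x)
    (hzx : F z ≤ F x) : NotDominatedBy F S z := fun ⟨y, hy, hyz⟩ => h ⟨y, hy, hyz.trans_le hzx⟩

lemma nondominated_subset (F : Pt n → Fin m → ℝ) (S : Set (Pt n)) : nondominated F S ⊆ S :=
  fun _ hx => hx.1

lemma mutuallyNondominated_nondominated (F : Pt n → Fin m → ℝ) (S : Set (Pt n)) :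
    MutuallyNondominated F (nondominated F S) := fun _ hx =>
  hx.2.mono (nondominated_subset F S)

/-- In a finite set every image lies above a minimal one, so discarding dominated points loses no
hyper-volume. -/
lemma weaklyCovers_nondominated {S : Set (Pt n)} (hS : S.Finite) :
    WeaklyCovers F (nondominated F S) S := by
  intro x hx
  obtain ⟨b, hbx, hb⟩ := (hS.image F).exists_le_minimal (mem_image_of_mem F hx)
  obtain ⟨y, hy, rfl⟩ := hb.1
  refine ⟨y, ⟨hy, ?_⟩, hbx⟩
  rintro ⟨z, hz, hzy⟩
  exact hb.not_lt (mem_image_of_mem F hz) hzy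

/-- A point that is not dominated by a set containing a point as good as `x₀` belongs to the level
set of `x₀`. -/
lemma mem_levelSet_of_notDominatedBy [NeZero m] {Ω S : Set (Pt n)} {x₀ w z : Pt n} (hz : z ∈ Ω)
    (hS : NotDominatedBy F S z) (hw : w ∈ S) (hwx : F w ≤ F x₀) : z ∈ levelSet F Ω x₀ := by
  have hnot : ¬ F w < F z := fun h => hS ⟨w, hw, h⟩
  suffices h : ∃ j, F z j ≤ F w j by
    obtain ⟨j, hj⟩ := h
    exact mem_iUnion.2 ⟨j, hz, hj.trans (hwx j)⟩
  -- Being worse in every component is dominance only because there is at least one component.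
  by_contra! h
  exact hnot (lt_of_le_of_ne (fun j => (h j).le) fun he => (h 0).ne (congrFun he 0))

lemma levelSet_subset (F : Pt n → Fin m → ℝ) (Ω : Set (Pt n)) (x₀ : Pt n) :
    levelSet F Ω x₀ ⊆ Ω :=
  iUnion_subset fun _ _ hx => hx.1

end Dominance

/-! ### Hyper-volume -/

section HyperVolume

variable {n m : ℕ} {F : Pt n → Fin m → ℝ}

lemma dominatedRegion_subset_of_weaklyCovers {S T : Set (Pt n)} (h : WeaklyCovers F T S)
    (ζ : Fin m → ℝ) : dominatedRegion ζ (F '' S) ⊆ dominatedRegion ζ (F '' T) := by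
  rintro w ⟨_, ⟨x, hx, rfl⟩, hxw, hwζ⟩
  obtain ⟨y, hy, hyx⟩ := h x hx
  exact ⟨F y, mem_image_of_mem F hy, hyx.trans hxw, hwζ⟩

lemma hyperVolume_mono {S T : Set (Pt n)} (h : WeaklyCovers F T S) (ζ : Fin m → ℝ) :
    hyperVolume F ζ S ≤ hyperVolume F ζ T :=
  measure_mono (dominatedRegion_subset_of_weaklyCovers h ζ)

lemma hyperVolume_mono_ref {ζ ζ' : Fin m → ℝ} (h : ζ ≤ ζ') (S : Set (Pt n)) :
    hyperVolume F ζ S ≤ hyperVolume F ζ' S :=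
  measure_mono fun _ ⟨y, hy, hyw, hw⟩ => ⟨y, hy, hyw, hw.trans h⟩

/-- The increase of the hyper-volume when a set covers `S` together with a point that improves a
point of `S` by at least `η` in each objective. -/
lemma hyperVolume_add_le [NeZero m] {S T : Set (Pt n)} (hS : MutuallyNondominated F S)
    (hTS : WeaklyCovers F T S) {c z : Pt n} (hc : c ∈ S) (hz : ∃ y ∈ T, F y ≤ F z)
    {η : ℝ} (hzc : ∀ j, F z j + η ≤ F c j) {ζ : Fin m → ℝ} (hζ : F c ≤ ζ) :
    hyperVolume F ζ S + ENNReal.ofReal η ^ m ≤ hyperVolume F ζ T := by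
  set Q : Set (Fin m → ℝ) := Set.pi univ fun j => Ico (F z j) (F c j) with hQ
  have hQvol : ENNReal.ofReal η ^ m ≤ volume Q := by
    rw [hQ, Real.volume_pi_Ico]
    calc ENNReal.ofReal η ^ m = ∏ _j : Fin m, ENNReal.ofReal η := by simp
      _ ≤ _ := Finset.prod_le_prod' fun j _ => ENNReal.ofReal_le_ofReal (by linarith [hzc j])
  have hQmeas : MeasurableSet Q := MeasurableSet.univ_pi fun j => measurableSet_Ico
  -- A point of `Q` is strictly below `F c` in every component; if some `y ∈ S` lay below it, `y`
  -- would dominate `c`.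
  have hdisj : Disjoint (dominatedRegion ζ (F '' S)) Q := by
    rw [Set.disjoint_left]
    rintro w ⟨_, ⟨y, hy, rfl⟩, hyw, -⟩ hwQ
    have hwc : ∀ j, w j < F c j := fun j => (hwQ j (mem_univ j)).2
    refine hS c hc ⟨y, hy, hyw.trans_lt (lt_of_le_of_ne (fun j => (hwc j).le) fun he => ?_)⟩
    exact (hwc 0).ne (congrFun he 0)
  have hsub : dominatedRegion ζ (F '' S) ∪ Q ⊆ dominatedRegion ζ (F '' T) := by
    refine union_subset (dominatedRegion_subset_of_weaklyCovers hTS ζ) fun w hw => ?_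
    obtain ⟨y, hy, hyz⟩ := hz
    exact ⟨F y, mem_image_of_mem F hy, hyz.trans fun j => (hw j (mem_univ j)).1,
      fun j => (hw j (mem_univ j)).2.le.trans (hζ j)⟩
  calc hyperVolume F ζ S + ENNReal.ofReal η ^ m
      ≤ volume (dominatedRegion ζ (F '' S)) + volume Q := by
        unfold hyperVolume; gcongr
    _ = volume (dominatedRegion ζ (F '' S) ∪ Q) := (measure_union hdisj hQmeas).symm
    _ ≤ hyperVolume F ζ T := measure_mono hsub

lemma le_refPoint {A : Set (Pt n)} (hA : A.Finite) {x : Pt n} (hx : x ∈ A) :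
    F x ≤ refPoint F A := fun _ =>
  le_csSup (hA.image _).bddAbove (mem_image_of_mem _ hx)

lemma refPoint_le {A : Set (Pt n)} (hA : A.Nonempty) {b : Fin m → ℝ} (h : ∀ x ∈ A, F x ≤ b) :
    refPoint F A ≤ b := fun j =>
  csSup_le (hA.image _) (by rintro _ ⟨x, hx, rfl⟩; exact h x hx j)

end HyperVolume

/-! ### The loops -/

section Loops

variable {n m : ℕ} {F : Pt n → Fin m → ℝ} {Ω : Set (Pt n)} {x₀ : Pt n} {p : Params}

/-- The invariant of the inner loops. -/
structure State.Admissible (F : Pt n → Fin m → ℝ) (Ω : Set (Pt n)) (x₀ : Pt n) (s : State n) :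
    Prop where
  finite : s.Xall.Finite
  subset : s.Xhat ⊆ s.Xall
  level : s.Xall ⊆ levelSet F Ω x₀
  nondom : MutuallyNondominated F s.Xhat
  cover : ∃ w ∈ s.Xhat, F w ≤ F x₀

/-- The state `t` knows all points that `s` knows, and its current set is at least as good. -/
structure State.Improves (F : Pt n → Fin m → ℝ) (t s : State n) : Prop where
  subset : s.Xall ⊆ t.Xall
  cover : WeaklyCovers F t.Xhat s.Xhat

lemma State.Improves.refl (s : State n) : s.Improves F s :=
  ⟨Subset.rfl, .of_subset Subset.rfl⟩

lemma State.Improves.trans {s t r : State n} (h₁ : r.Improves F t) (h₂ : t.Improves F s) :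
    r.Improves F s :=
  ⟨h₂.subset.trans h₁.subset, h₁.cover.trans h₂.cover⟩

lemma State.mem_add_Xhat (F : Pt n → Fin m → ℝ) (s : State n) (z : Pt n) :
    z ∈ (s.add F z).Xhat :=
  ⟨Or.inr rfl, fun h => lt_irrefl _ h.2⟩

lemma State.add_improves (F : Pt n → Fin m → ℝ) (s : State n) (z : Pt n) :
    (s.add F z).Improves F s := by
  refine ⟨subset_union_left, fun x hx => ?_⟩
  by_cases h : F z < F x
  · exact ⟨z, s.mem_add_Xhat F z, h.le⟩
  · exact ⟨x, ⟨Or.inl hx, fun h' => h h'.2⟩, le_rfl⟩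

lemma State.Admissible.add [NeZero m] {s : State n} (hs : s.Admissible F Ω x₀) {z : Pt n}
    (hz : z ∈ Ω) (hnd : NotDominatedBy F s.Xhat z) : (s.add F z).Admissible F Ω x₀ := by
  obtain ⟨w, hw, hwx⟩ := hs.cover
  refine ⟨hs.finite.union (finite_singleton z), ?_, ?_, ?_, ?_⟩
  · exact sdiff_subset.trans (union_subset_union_left _ hs.subset)
  · refine union_subset hs.level (singleton_subset_iff.2 ?_)
    exact mem_levelSet_of_notDominatedBy hz hnd hw hwx
  · rintro x ⟨hx, hxz⟩ ⟨y, ⟨hy, -⟩, hyx⟩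
    rcases hx with hx | rfl
    · rcases hy with hy | rfl
      · exact hs.nondom x hx ⟨y, hy, hyx⟩
      · exact hxz ⟨hx, hyx⟩
    · rcases hy with hy | rfl
      · exact hnd ⟨y, hy, hyx⟩
      · exact lt_irrefl _ hyx
  · obtain ⟨y, hy, hyw⟩ := (s.add_improves F z).cover w hw
    exact ⟨y, hy, hyw.trans hwx⟩

lemma IsLineSearchStep.pos_le_one {P : ℝ → Prop} {α : ℝ} (h : IsLineSearchStep p P α)
    (hα₀ : 0 < p.α₀ ∧ p.α₀ ≤ 1) (hδ : 0 < p.δ ∧ p.δ < 1) : 0 < α ∧ α ≤ 1 := by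
  obtain ⟨⟨h, rfl⟩, -⟩ := h.1
  have := hα₀.1
  have := hδ.1
  exact ⟨by positivity, mul_le_one₀ hα₀.2 (by positivity) (pow_le_one₀ hδ.1.le hδ.2.le)⟩

/-- The exploration line search demands that every point of the current set be beaten in some
objective, which already says that the accepted point is not dominated. -/
lemma Explore.admissible [NeZero m] (hΩ : IsClosed Ω) (hconv : Convex ℝ Ω)
    (hα₀ : 0 < p.α₀ ∧ p.α₀ ≤ 1) (hδ : 0 < p.δ ∧ p.δ < 1) {z : Pt n} (hz : z ∈ Ω)
    {Is : List (Finset (Fin m))} {s t : State n} (h : Explore F Ω p z Is s t)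
    (hIs : ∀ I ∈ Is, I.Nonempty) (hs : s.Admissible F Ω x₀) :
    t.Admissible F Ω x₀ ∧ t.Improves F s := by
  induction h with
  | done s => exact ⟨hs, .refl s⟩
  | skip I Is s t _ _ ih => exact ih (fun J hJ => hIs J (List.mem_cons_of_mem _ hJ)) hs
  | step I Is s t α _ hα _ ih =>
    obtain ⟨hpos, hle⟩ := hα.pos_le_one hα₀ hδ
    have hdir := isProjectedDirection_vI F hΩ (hIs I List.mem_cons_self) hz
    have hmem := add_smul_mem_of_convex hconv hz hdir.1 hpos.le hle
    have hnd : NotDominatedBy F s.Xhat (z + α • vI F Ω I z) := by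
      rintro ⟨y, hy, hyz⟩
      obtain ⟨j, hj⟩ := hα.1.2 y hy
      exact absurd (hyz.le j) (not_le.2 hj)
    obtain ⟨h₁, h₂⟩ := ih (fun J hJ => hIs J (List.mem_cons_of_mem _ hJ)) (hs.add hmem hnd)
    exact ⟨h₁, h₂.trans (s.add_improves F _)⟩

/-- The refined point is at least as good as an undominated one: some `c ∈ S` in the nonmonotone
case, `x` itself otherwise. A dominator of it would dominate that point too. -/
lemma IsRefineStep.mem_and_notDominatedBy [NeZero m] (hΩ : IsClosed Ω) (hconv : Convex ℝ Ω)
    (hα₀ : 0 < p.α₀ ∧ p.α₀ ≤ 1) (hδ : 0 < p.δ ∧ p.δ < 1) (hγ : 0 < p.γ) {σ : ℝ}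
    {S : Set (Pt n)} (hS : MutuallyNondominated F S) {x : Pt n} (hx : x ∈ Ω)
    (hnd : NotDominatedBy F S x) {α : ℝ} (h : IsRefineStep F Ω p σ S x α) :
    x + α • v F Ω x ∈ Ω ∧ NotDominatedBy F S (x + α • v F Ω x) := by
  by_cases hθ : theta F Ω x < -σ
  · have hD : D F x (v F Ω x) ≤ 0 := (D_v_le_theta F hΩ hx).trans (theta_nonpos F hΩ hx)
    have hmem : 0 < α → α ≤ 1 → x + α • v F Ω x ∈ Ω := fun h₀ h₁ =>
      add_smul_mem_of_convex hconv hx (add_v_mem F hΩ hx) h₀.le h₁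
    have hle : 0 < α → p.γ * α * D F x (v F Ω x) ≤ 0 := fun h₀ =>
      mul_nonpos_of_nonneg_of_nonpos (by positivity) hD
    by_cases hc : ∃ c ∈ S, F x ≤ F c
    · have hls := (h.1 hθ).1 hc
      obtain ⟨hpos, hle₁⟩ := hls.pos_le_one hα₀ hδ
      obtain ⟨-, c, hcS, -, hdec⟩ := hls.1
      exact ⟨hmem hpos hle₁, (hS c hcS).of_le fun j => by linarith [hdec j, hle hpos]⟩
    · have hls := (h.1 hθ).2 hc
      obtain ⟨hpos, hle₁⟩ := hls.pos_le_one hα₀ hδ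
      obtain ⟨-, hdec⟩ := hls.1
      exact ⟨hmem hpos hle₁, hnd.of_le fun j => by linarith [hdec j, hle hpos]⟩
  · rw [h.2 hθ]
    simpa using ⟨hx, hnd⟩

lemma ProcessPoint.admissible [NeZero m] (hΩ : IsClosed Ω) (hconv : Convex ℝ Ω)
    (hα₀ : 0 < p.α₀ ∧ p.α₀ ≤ 1) (hδ : 0 < p.δ ∧ p.δ < 1) (hγ : 0 < p.γ) {σ : ℝ}
    {x : Pt n} (hx : x ∈ Ω) {s t : State n} (h : ProcessPoint F Ω p σ x s t)
    (hs : s.Admissible F Ω x₀) : t.Admissible F Ω x₀ ∧ t.Improves F s := by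
  rcases h with ⟨-, rfl⟩ | ⟨hnd, α, z, Is, hα, rfl, -, hIs, hex⟩
  · exact ⟨hs, .refl _⟩
  · obtain ⟨hz, hznd⟩ := hα.mem_and_notDominatedBy hΩ hconv hα₀ hδ hγ hs.nondom hx hnd
    obtain ⟨h₁, h₂⟩ := hex.admissible hΩ hconv hα₀ hδ hz (fun I hI => ((hIs I).1 hI).1)
      (hs.add hz hznd)
    exact ⟨h₁, h₂.trans (s.add_improves F _)⟩

lemma ProcessList.admissible [NeZero m] (hΩ : IsClosed Ω) (hconv : Convex ℝ Ω)
    (hα₀ : 0 < p.α₀ ∧ p.α₀ ≤ 1) (hδ : 0 < p.δ ∧ p.δ < 1) (hγ : 0 < p.γ) {σ : ℝ}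
    {xs : List (Pt n)} {s t : State n} (h : ProcessList F Ω p σ xs s t)
    (hxs : ∀ x ∈ xs, x ∈ Ω) (hs : s.Admissible F Ω x₀) :
    t.Admissible F Ω x₀ ∧ t.Improves F s := by
  induction h with
  | nil s => exact ⟨hs, .refl s⟩
  | cons x xs s s' t hx _ ih =>
    obtain ⟨h₁, h₂⟩ := hx.admissible hΩ hconv hα₀ hδ hγ (hxs x List.mem_cons_self) hs
    obtain ⟨h₃, h₄⟩ := ih (fun y hy => hxs y (List.mem_cons_of_mem _ hy)) h₁
    exact ⟨h₃, h₄.trans h₂⟩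

/-- If the first point of the list is not skipped, the final state covers the point it is refined
to. -/
lemma ProcessList.exists_refineStep [NeZero m] (hΩ : IsClosed Ω) (hconv : Convex ℝ Ω)
    (hα₀ : 0 < p.α₀ ∧ p.α₀ ≤ 1) (hδ : 0 < p.δ ∧ p.δ < 1) (hγ : 0 < p.γ) {σ : ℝ}
    {x : Pt n} {xs : List (Pt n)} {s t : State n} (h : ProcessList F Ω p σ (x :: xs) s t)
    (hxs : ∀ y ∈ x :: xs, y ∈ Ω) (hs : s.Admissible F Ω x₀) (hnd : NotDominatedBy F s.Xhat x) :
    ∃ α, IsRefineStep F Ω p σ s.Xhat x α ∧ ∃ y ∈ t.Xhat, F y ≤ F (x + α • v F Ω x) := by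
  obtain _ | ⟨_, _, _, s', _, hx, hrest⟩ := h
  have hxΩ := hxs x List.mem_cons_self
  have hs' := (hx.admissible hΩ hconv hα₀ hδ hγ hxΩ hs).1
  have hts' := (hrest.admissible hΩ hconv hα₀ hδ hγ
    (fun y hy => hxs y (List.mem_cons_of_mem _ hy)) hs').2
  rcases hx with ⟨hd, -⟩ | ⟨-, α, z, Is, hα, rfl, -, hIs, hex⟩
  · exact absurd hnd hd
  · obtain ⟨hz, hznd⟩ := hα.mem_and_notDominatedBy hΩ hconv hα₀ hδ hγ hs.nondom hxΩ hnd
    have h₂ := (hex.admissible hΩ hconv hα₀ hδ hz (fun I hI => ((hIs I).1 hI).1)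
      (hs.add hz hznd)).2
    exact ⟨α, hα, (hts'.trans h₂).cover _ (s.mem_add_Xhat F _)⟩

/-- A step that satisfies the Armijo condition for all small values is bounded below when `x` is
covered by the current set, and the resulting point improves a point of the current set. -/
lemma IsRefineStep.exists_sufficient_decrease {σ : ℝ} {S : Set (Pt n)} {x : Pt n} {α : ℝ}
    (h : IsRefineStep F Ω p σ S x α) (hθ : theta F Ω x < -σ) (hc : ∃ c ∈ S, F x ≤ F c)
    {k : ℕ} (hk : ∀ j, F (x + (p.α₀ * p.δ ^ k) • v F Ω x) j ≤
      F x j + p.γ * (p.α₀ * p.δ ^ k) * D F x (v F Ω x)) :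
    p.α₀ * p.δ ^ k ≤ α ∧ ∃ c ∈ S,
      ∀ j, F (x + α • v F Ω x) j ≤ F c j + p.γ * α * D F x (v F Ω x) := by
  have hls := (h.1 hθ).1 hc
  obtain ⟨c, hcS, hxc⟩ := hc
  -- Armijo decrease from `F x` gives decrease from `F c ≥ F x`, so this trial step is admissible
  -- and the largest one is no smaller. The search may succeed with a different reference point
  -- `c'`.
  refine ⟨hls.2 ⟨⟨k, rfl⟩, c, hcS, hxc, fun j => (hk j).trans (by linarith [hxc j])⟩, ?_⟩
  obtain ⟨-, c', hc', -, hdec⟩ := hls.1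
  exact ⟨c', hc', hdec⟩

end Loops

/-! ### The reference sets -/

section RefSet

variable {n m : ℕ} {F : Pt n → Fin m → ℝ} {Xl Cp X : Set (Pt n)}

lemma refSet_subset : refSet F Xl Cp X ⊆ Xl ∪ Cp ∪ X :=
  union_subset_union (nondominated_subset F _) fun _ hx => hx.1

lemma weaklyCovers_refSet (h : (Xl ∪ Cp).Finite) :
    WeaklyCovers F (refSet F Xl Cp X) (Xl ∪ Cp) :=
  (WeaklyCovers.of_subset subset_union_left).trans (weaklyCovers_nondominated h)

/-- A point added from `X` cannot dominate a point of `C̄`, being strictly worse somewhere; the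
converse dominance is excluded by `hXC`. -/
lemma mutuallyNondominated_refSet (hX : MutuallyNondominated F X)
    (hXC : ∀ x ∈ X, NotDominatedBy F (Xl ∪ Cp) x) :
    MutuallyNondominated F (refSet F Xl Cp X) := by
  rintro x hx ⟨y, hy | hy, hyx⟩
  · rcases hx with hx | hx
    · exact hx.2 ⟨y, hy.1, hyx⟩
    · exact hXC x hx.1 ⟨y, hy.1, hyx⟩
  · rcases hx with hx | hx
    · obtain ⟨j, hj⟩ := hy.2 x hx
      exact absurd (hyx.le j) (not_le.2 hj)
    · exact hX x hx.1 ⟨y, hy.1, hyx⟩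

/-- This is why the first processed point is never skipped. -/
lemma notDominatedBy_refSet (hX : MutuallyNondominated F X)
    (hXC : ∀ x ∈ X, NotDominatedBy F (Xl ∪ Cp) x) {x : Pt n} (hx : x ∈ X) :
    NotDominatedBy F (refSet F Xl Cp X) x := by
  rintro ⟨y, hy | hy, hyx⟩
  · exact hXC x hx ⟨y, hy.1, hyx⟩
  · exact hX x hx ⟨y, hy.1, hyx⟩

/-- Either `C̄` supplies `c`, or `x` meets the very condition for being added and `c = x` works.
Hence the first processed point always has a nonmonotone reference. -/
lemma exists_refSet_ge {x : Pt n} (hx : x ∈ X) : ∃ c ∈ refSet F Xl Cp X, F x ≤ F c := by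
  by_cases h : ∃ c ∈ refSetBar F Xl Cp, F x ≤ F c
  · obtain ⟨c, hc, hxc⟩ := h
    exact ⟨c, Or.inl hc, hxc⟩
  · push Not at h
    refine ⟨x, Or.inr ⟨hx, fun y hy => ?_⟩, le_rfl⟩
    simpa [Pi.le_def] using h y hy

end RefSet

end FPDNMT

namespace FPDNMT

/-! ### Runs -/

section Runs

variable {n m : ℕ} {F : Pt n → Fin m → ℝ} {Ω : Set (Pt n)} {p : Params} {X0 : Set (Pt n)}
  {x₀ : Pt n}

/-- The invariant of the outer loop at the beginning of iteration `k`. -/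
structure Run.Invariant (R : Run F Ω p X0) (x₀ : Pt n) (k : ℕ) : Prop where
  finite : (R.Xall k).Finite
  level : R.Xall k ⊆ levelSet F Ω x₀
  X_subset : ∀ i ≤ k, R.X i ⊆ R.Xall k
  prevC_subset : prevC R.C k ⊆ R.Xall k
  X_nondom : MutuallyNondominated F (R.X k)
  X_notDominatedBy : ∀ x ∈ R.X k, NotDominatedBy F (R.X (R.l k) ∪ prevC R.C k) x
  cover : ∃ w ∈ R.X (R.l k) ∪ prevC R.C k, F w ≤ F x₀

lemma Run.invariant_zero [NeZero m] (R : Run F Ω p X0) (hX0 : X0 ⊆ Ω)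
    (hX0nd : MutuallyNondominated F X0) (hx₀ : x₀ ∈ X0) : R.Invariant x₀ 0 := by
  have hl : R.l 0 = 0 := Nat.le_zero.1 (R.l_mem 0).1
  have hX : R.X (R.l 0) ∪ prevC R.C 0 = X0 := by rw [hl, R.X_zero]; simp [prevC]
  refine ⟨?_, ?_, ?_, ?_, ?_, ?_, ?_⟩
  -- Finiteness of `X^0` comes from the list in which its points are processed.
  · rw [R.Xall_zero, ← R.X_zero]
    exact (R.order 0).finite_toSet.subset fun x hx => (R.mem_order 0 x).2 hx
  · rw [R.Xall_zero]
    exact fun x hx => mem_levelSet_of_notDominatedBy (hX0 hx) (hX0nd x hx) hx₀ le_rfl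
  · intro i hi
    rw [Nat.le_zero.1 hi, R.X_zero, R.Xall_zero]
  · exact empty_subset _
  · rwa [R.X_zero]
  · rw [hX, R.X_zero]
    exact hX0nd
  · rw [hX]
    exact ⟨x₀, hx₀, le_rfl⟩

lemma Run.Invariant.admissible {R : Run F Ω p X0} {k : ℕ} (h : R.Invariant x₀ k) :
    State.Admissible F Ω x₀ ⟨R.C k, R.Xall k⟩ := by
  have hsub : R.X (R.l k) ∪ prevC R.C k ⊆ R.Xall k :=
    union_subset (h.X_subset _ (R.l_mem k).1) h.prevC_subset
  refine ⟨h.finite, ?_, h.level, ?_, ?_⟩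
  · change R.C k ⊆ R.Xall k
    rw [R.C_eq]
    exact refSet_subset.trans (union_subset hsub (h.X_subset k le_rfl))
  · change MutuallyNondominated F (R.C k)
    rw [R.C_eq]
    exact mutuallyNondominated_refSet h.X_nondom h.X_notDominatedBy
  · obtain ⟨w, hw, hwx⟩ := h.cover
    obtain ⟨y, hy, hyw⟩ := weaklyCovers_refSet (X := R.X k) (h.finite.subset hsub) w hw
    rw [← R.C_eq] at hy
    exact ⟨y, hy, hyw.trans hwx⟩

lemma Run.Invariant.order_subset {R : Run F Ω p X0} {k : ℕ} (h : R.Invariant x₀ k) :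
    ∀ x ∈ R.order k, x ∈ Ω := fun x hx =>
  levelSet_subset F Ω x₀ (h.level (h.X_subset k le_rfl ((R.mem_order k x).1 hx)))

lemma Run.Invariant.C_covers {R : Run F Ω p X0} {k : ℕ} (h : R.Invariant x₀ k) :
    WeaklyCovers F (R.C k) (R.X (R.l k)) := by
  rw [R.C_eq]
  exact (weaklyCovers_refSet (h.finite.subset (union_subset (h.X_subset _ (R.l_mem k).1)
    h.prevC_subset))).trans (.of_subset subset_union_left)

variable [NeZero m]

lemma Run.Invariant.loop {R : Run F Ω p X0} {k : ℕ} (h : R.Invariant x₀ k) (hΩ : IsClosed Ω)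
    (hconv : Convex ℝ Ω) (hα₀ : 0 < p.α₀ ∧ p.α₀ ≤ 1) (hδ : 0 < p.δ ∧ p.δ < 1) (hγ : 0 < p.γ) :
    State.Admissible F Ω x₀ ⟨R.Xhat k, R.Xall (k + 1)⟩ ∧
      State.Improves F ⟨R.Xhat k, R.Xall (k + 1)⟩ ⟨R.C k, R.Xall k⟩ :=
  (R.loop k).admissible hΩ hconv hα₀ hδ hγ h.order_subset h.admissible

lemma Run.Invariant.Xhat_union_Xbar_subset {R : Run F Ω p X0} {k : ℕ} (h : R.Invariant x₀ k)
    (hΩ : IsClosed Ω) (hconv : Convex ℝ Ω) (hα₀ : 0 < p.α₀ ∧ p.α₀ ≤ 1)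
    (hδ : 0 < p.δ ∧ p.δ < 1) (hγ : 0 < p.γ) : R.Xhat k ∪ R.Xbar k ⊆ R.Xall (k + 1) := by
  obtain ⟨hadm, himp⟩ := h.loop hΩ hconv hα₀ hδ hγ
  refine union_subset hadm.subset ?_
  rcases R.Xbar_mem k with hX | ⟨i, hi, -, hX⟩ <;> rw [hX]
  · exact hadm.subset
  · exact (h.X_subset i hi).trans himp.subset

lemma Run.Invariant.X_succ_covers {R : Run F Ω p X0} {k : ℕ} (h : R.Invariant x₀ k)
    (hΩ : IsClosed Ω) (hconv : Convex ℝ Ω) (hα₀ : 0 < p.α₀ ∧ p.α₀ ≤ 1)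
    (hδ : 0 < p.δ ∧ p.δ < 1) (hγ : 0 < p.γ) : WeaklyCovers F (R.X (k + 1)) (R.Xhat k) := by
  rw [R.X_succ]
  exact (weaklyCovers_nondominated ((h.loop hΩ hconv hα₀ hδ hγ).1.finite.subset
    (h.Xhat_union_Xbar_subset hΩ hconv hα₀ hδ hγ))).trans (.of_subset subset_union_left)

lemma Run.Invariant.succ {R : Run F Ω p X0} {k : ℕ} (h : R.Invariant x₀ k) (hΩ : IsClosed Ω)
    (hconv : Convex ℝ Ω) (hα₀ : 0 < p.α₀ ∧ p.α₀ ≤ 1) (hδ : 0 < p.δ ∧ p.δ < 1) (hγ : 0 < p.γ)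
    (hsame : R.SameWorstSet) : R.Invariant x₀ (k + 1) := by
  obtain ⟨hadm, himp⟩ := h.loop hΩ hconv hα₀ hδ hγ
  have hC : WeaklyCovers F (R.Xhat k ∪ R.Xbar k) (R.C k) :=
    (WeaklyCovers.of_subset subset_union_left).trans himp.cover
  refine ⟨hadm.finite, hadm.level, fun i hi => ?_, h.admissible.subset.trans himp.subset, ?_, ?_,
    ?_⟩
  · rcases Nat.le_succ_iff.1 hi with hi | rfl
    · exact (h.X_subset i hi).trans himp.subset
    · rw [R.X_succ]
      exact (nondominated_subset F _).trans (h.Xhat_union_Xbar_subset hΩ hconv hα₀ hδ hγ)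
  · rw [R.X_succ]
    exact mutuallyNondominated_nondominated F _
  · intro x hx
    rw [R.X_succ] at hx
    -- Assumption 2 enters here: `X^{k+1}` was filtered against `X̄^{l(k)}`, which is now
    -- `X^{l(k+1)}`, and against `X̂^k`, which covers `C^k`.
    rw [← hsame k]
    exact hx.2.of_weaklyCovers ((WeaklyCovers.of_subset subset_union_right).union hC)
  · obtain ⟨w, hw, hwx⟩ := h.admissible.cover
    exact ⟨w, Or.inr hw, hwx⟩

lemma Run.invariant (R : Run F Ω p X0) (hΩ : IsClosed Ω) (hconv : Convex ℝ Ω)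
    (hα₀ : 0 < p.α₀ ∧ p.α₀ ≤ 1) (hδ : 0 < p.δ ∧ p.δ < 1) (hγ : 0 < p.γ)
    (hX0 : X0 ⊆ Ω) (hX0nd : MutuallyNondominated F X0) (hx₀ : x₀ ∈ X0) (hsame : R.SameWorstSet)
    (k : ℕ) : R.Invariant x₀ k := by
  induction k with
  | zero => exact R.invariant_zero hX0 hX0nd hx₀
  | succ k ih => exact ih.succ hΩ hconv hα₀ hδ hγ hsame

/-- If the first processed point is not almost stationary, the hyper-volume of the next iterate
exceeds the one of `X^{l(k)}` by a fixed amount. -/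
lemma Run.Invariant.hyperVolume_gain {R : Run F Ω p X0} {k : ℕ} (h : R.Invariant x₀ k)
    (hΩ : IsClosed Ω) (hconv : Convex ℝ Ω) (hα₀ : 0 < p.α₀ ∧ p.α₀ ≤ 1)
    (hδ : 0 < p.δ ∧ p.δ < 1) (hγ : 0 < p.γ) (hfirst : R.FirstLeastStationary)
    {ε : ℝ} (hσε : p.σ k ≤ ε) (hΘ : Theta F Ω (R.X k) < -ε) (hε : 0 < ε) {i : ℕ}
    (hi : ∀ x ∈ levelSet F Ω x₀, theta F Ω x < -ε → ∀ j,
      F (x + (p.α₀ * p.δ ^ i) • v F Ω x) j ≤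
        F x j + p.γ * (p.α₀ * p.δ ^ i) * D F x (v F Ω x))
    {ζ : Fin m → ℝ} (hζ : ∀ x ∈ R.Xall k, F x ≤ ζ) :
    hyperVolume F ζ (R.X (R.l k)) + ENNReal.ofReal (p.γ * (p.α₀ * p.δ ^ i) * ε) ^ m ≤
      hyperVolume F ζ (R.X (k + 1)) := by
  have hne : (R.X k).Nonempty := by
    -- The infimum over the empty set is `0` by convention, which is not below `-ε`.
    by_contra hem
    rw [not_nonempty_iff_eq_empty.1 hem] at hΘ
    simp only [Theta, image_empty, Real.sInf_empty] at hΘ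
    linarith
  obtain ⟨_, ⟨x', hx', rfl⟩, hθ'⟩ := exists_lt_of_csInf_lt (hne.image _) hΘ
  obtain ⟨x, xs, hord⟩ := List.exists_cons_of_ne_nil
    (List.ne_nil_of_mem ((R.mem_order k x').2 hx'))
  have hxX : x ∈ R.X k := (R.mem_order k x).1 (by rw [hord]; exact List.mem_cons_self)
  have hθ : theta F Ω x < -ε :=
    (hfirst k x (by rw [hord]; rfl) x' hx').trans_lt hθ'
  have hxL : x ∈ levelSet F Ω x₀ := h.level (h.X_subset k le_rfl hxX)
  have hxΩ : x ∈ Ω := levelSet_subset F Ω x₀ hxL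
  have hnd : NotDominatedBy F (R.C k) x := by
    rw [R.C_eq]
    exact notDominatedBy_refSet h.X_nondom h.X_notDominatedBy hxX
  have hge : ∃ c ∈ R.C k, F x ≤ F c := by
    rw [R.C_eq]
    exact exists_refSet_ge hxX
  have hloop := R.loop k
  have hsub := h.order_subset
  rw [hord] at hloop hsub
  obtain ⟨α, hα, hz⟩ := hloop.exists_refineStep hΩ hconv hα₀ hδ hγ hsub h.admissible hnd
  obtain ⟨hαi, c, hc, hdec⟩ := hα.exists_sufficient_decrease (by linarith) hge (hi x hxL hθ)
  have hD : D F x (v F Ω x) < -ε := (D_v_le_theta F hΩ hxΩ).trans_lt hθ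
  have hcov := h.X_succ_covers hΩ hconv hα₀ hδ hγ
  obtain ⟨y, hy, hyz⟩ := hz
  obtain ⟨y', hy', hyy'⟩ := hcov y hy
  have hpos : 0 < p.α₀ * p.δ ^ i := mul_pos hα₀.1 (pow_pos hδ.1 i)
  calc hyperVolume F ζ (R.X (R.l k)) + ENNReal.ofReal (p.γ * (p.α₀ * p.δ ^ i) * ε) ^ m
      ≤ hyperVolume F ζ (R.C k) + ENNReal.ofReal (p.γ * (p.α₀ * p.δ ^ i) * ε) ^ m := by
        gcongr
        exact hyperVolume_mono h.C_covers ζ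
    _ ≤ hyperVolume F ζ (R.X (k + 1)) := by
        refine hyperVolume_add_le h.admissible.nondom
          (hcov.trans (h.loop hΩ hconv hα₀ hδ hγ).2.cover) hc ⟨y', hy', hyy'.trans hyz⟩
          (fun j => ?_) (hζ c (h.admissible.subset hc))
        have h₁ : p.γ * (p.α₀ * p.δ ^ i) * ε ≤ p.γ * α * ε := by gcongr
        have h₂ : p.γ * α * D F x (v F Ω x) ≤ p.γ * α * (-ε) :=
          mul_le_mul_of_nonneg_left hD.le (mul_nonneg hγ.le (hpos.le.trans hαi))
        linarith [hdec j]

/-- The hyper-volume of `X^{l(k)}`, with the reference point of iteration `k`. -/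
noncomputable def Run.worstVolume (R : Run F Ω p X0) (k : ℕ) : ℝ≥0∞ :=
  hyperVolume F (refPoint F (R.Xall k)) (R.X (R.l k))

/-- Infinitely often the iterate is almost stationary. -/
lemma Run.exists_neg_le_Theta (R : Run F Ω p X0) (hF : ContDiff ℝ 1 F) (hΩ : IsClosed Ω)
    (hconv : Convex ℝ Ω) (hα₀ : 0 < p.α₀ ∧ p.α₀ ≤ 1) (hδ : 0 < p.δ ∧ p.δ < 1)
    (hγ : 0 < p.γ ∧ p.γ < 1) (hX0 : X0 ⊆ Ω) (hX0nd : MutuallyNondominated F X0) (hx₀ : x₀ ∈ X0)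
    (hL : IsCompact (levelSet F Ω x₀)) (hfirst : R.FirstLeastStationary)
    (hsame : R.SameWorstSet) {ε : ℝ} (hε : 0 < ε) {N : ℕ} (hσ : ∀ k ≥ N, p.σ k ≤ ε) :
    ∃ k ≥ N, -ε ≤ Theta F Ω (R.X k) := by
  by_contra! hΘ
  have hinv := R.invariant hΩ hconv hα₀ hδ hγ.1 hX0 hX0nd hx₀ hsame
  obtain ⟨ρ, hρ, harm⟩ := exists_uniform_armijo_step hF hΩ hL (levelSet_subset F Ω x₀) hγ.2 hε
  obtain ⟨i, hi⟩ : ∃ i : ℕ, p.α₀ * p.δ ^ i ≤ ρ := by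
    obtain ⟨i, hi⟩ := exists_pow_lt_of_lt_one hρ hδ.2
    exact ⟨i, (mul_le_of_le_one_left (pow_nonneg hδ.1.le i) hα₀.2).trans hi.le⟩
  have hpos : 0 < p.α₀ * p.δ ^ i := mul_pos hα₀.1 (pow_pos hδ.1 i)
  set η : ℝ≥0∞ := ENNReal.ofReal (p.γ * (p.α₀ * p.δ ^ i) * ε) ^ m with hη
  have hη₀ : η ≠ 0 :=
    pow_ne_zero _ (ENNReal.ofReal_pos.2 (mul_pos (mul_pos hγ.1 hpos) hε)).ne'
  have hmono : Monotone R.Xall := monotone_nat_of_le_succ fun k =>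
    ((hinv k).loop hΩ hconv hα₀ hδ hγ.1).2.subset
  have hne : ∀ k, (R.Xall k).Nonempty := fun k =>
    ⟨x₀, hmono (Nat.zero_le k) (by rw [R.Xall_zero]; exact hx₀)⟩
  have href : ∀ {j k}, j ≤ k → ∀ x ∈ R.Xall j, F x ≤ refPoint F (R.Xall k) := fun hjk x hx =>
    le_refPoint (hinv _).finite (hmono hjk hx)
  have hrefmono : Monotone fun k => refPoint F (R.Xall k) := fun j k hjk =>
    refPoint_le (hne j) (href hjk)
  have hWmono : Monotone R.worstVolume := by
    refine monotone_nat_of_le_succ fun k => ?_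
    -- Compare at the old reference point. Either `l(k+1)` already lies in the window of iteration
    -- `k`, or it is `k + 1` and the new iterate covers `X^{l(k)}` through `X̂^k` and `C^k`.
    have hstep : R.worstVolume k ≤ hyperVolume F (refPoint F (R.Xall k)) (R.X (R.l (k + 1))) := by
      rcases Nat.le_succ_iff.1 (R.l_mem (k + 1)).1 with hl | hl
      · exact R.l_min k _ hl (by have := (R.l_mem (k + 1)).2; omega)
      · rw [hl]
        exact hyperVolume_mono ((((hinv k).X_succ_covers hΩ hconv hα₀ hδ hγ.1).trans
          ((hinv k).loop hΩ hconv hα₀ hδ hγ.1).2.cover).trans (hinv k).C_covers) _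
    exact hstep.trans (hyperVolume_mono_ref (hrefmono k.le_succ) _)
  have hgain : ∀ k ≥ N, R.worstVolume k + η ≤ R.worstVolume (k + (p.M + 1)) := by
    intro k hk
    obtain ⟨hl₁, hl₂⟩ := R.l_mem (k + (p.M + 1))
    -- After `M + 1` iterations the window starts at `k + 1`, so the selected set was created in
    -- some iteration `j ≥ k` and carries the gain of that iteration.
    obtain ⟨j, hj⟩ : ∃ j, R.l (k + (p.M + 1)) = j + 1 :=
      Nat.exists_eq_succ_of_ne_zero (by omega)
    have hkj : k ≤ j := by omega
    have hj' : j ≤ k + (p.M + 1) := by omega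
    calc R.worstVolume k + η ≤ R.worstVolume j + η := by gcongr; exact hWmono hkj
      _ ≤ hyperVolume F (refPoint F (R.Xall (k + (p.M + 1)))) (R.X (R.l j)) + η := by
          gcongr
          exact hyperVolume_mono_ref (hrefmono hj') _
      _ ≤ hyperVolume F (refPoint F (R.Xall (k + (p.M + 1)))) (R.X (j + 1)) :=
          (hinv j).hyperVolume_gain hΩ hconv hα₀ hδ hγ.1 hfirst (hσ j (hk.trans hkj))
            (hΘ j (hk.trans hkj)) hε (fun x hx hθ => harm x hx hθ _ hpos hi) (href hj')
      _ = R.worstVolume (k + (p.M + 1)) := by rw [Run.worstVolume, hj]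
  have hgrow : ∀ r : ℕ, (r : ℝ≥0∞) * η ≤ R.worstVolume (N + r * (p.M + 1)) := by
    intro r
    induction r with
    | zero => simp
    | succ r ih =>
      calc ((r + 1 : ℕ) : ℝ≥0∞) * η = r * η + η := by push_cast; ring
        _ ≤ R.worstVolume (N + r * (p.M + 1)) + η := by gcongr
        _ ≤ R.worstVolume (N + r * (p.M + 1) + (p.M + 1)) := hgain _ (by omega)
        _ = _ := by congr 1; ring
  have hbdd := (hL.image hF.continuous).isBounded
  obtain ⟨a, ha⟩ := hbdd.bddBelow
  obtain ⟨b, hb⟩ := hbdd.bddAbove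
  -- The reference points vary with `k`, but all are maxima over points of the level set and so stay
  -- below `b`.
  have hWle : ∀ k, R.worstVolume k ≤ volume (Icc a b) := by
    refine fun k => measure_mono ?_
    rintro w ⟨_, ⟨x, hx, rfl⟩, hxw, hw⟩
    refine ⟨(ha (mem_image_of_mem F ((hinv k).level
      ((hinv k).X_subset _ (R.l_mem k).1 hx)))).trans hxw, hw.trans (refPoint_le (hne k) ?_)⟩
    exact fun y hy => hb (mem_image_of_mem F ((hinv k).level hy))
  have hfin : volume (Icc a b) ≠ ∞ := isCompact_Icc.measure_lt_top.ne
  obtain ⟨r, hr⟩ := ENNReal.exists_nat_mul_gt hη₀ hfin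
  exact absurd hr (not_lt.2 ((hgrow r).trans (hWle _)))

end Runs

end FPDNMT

/-! ### Choice of the index set `K` -/

theorem theorem1 {n m : ℕ} (hm : 0 < m)
    (F : FPDNMT.Pt n → Fin m → ℝ) (hF : ContDiff ℝ 1 F)
    (l u : Fin n → EReal)
    (p : FPDNMT.Params)
    (hα₀ : 0 < p.α₀ ∧ p.α₀ ≤ 1) (hδ : 0 < p.δ ∧ p.δ < 1) (hγ : 0 < p.γ ∧ p.γ < 1)
    (hσ : ∀ k, 0 ≤ p.σ k)
    (X0 : Set (FPDNMT.Pt n)) (hX0 : X0 ⊆ FPDNMT.box l u)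
    (hX0nd : FPDNMT.MutuallyNondominated F X0)
    (x₀ : FPDNMT.Pt n) (hx₀ : x₀ ∈ X0)
    (hL : IsCompact (FPDNMT.levelSet F (FPDNMT.box l u) x₀))
    (R : FPDNMT.Run F (FPDNMT.box l u) p X0)
    (hfirst : R.FirstLeastStationary) (hsame : R.SameWorstSet) :
    ∃ K : Set ℕ, K.Infinite ∧
      (∀ σ : ℝ, 0 < σ → (∀ k, p.σ k = σ) →
        ∃ kbar ∈ K, ∀ k ∈ K, kbar ≤ k → -σ ≤ FPDNMT.Theta F (FPDNMT.box l u) (R.X k)) ∧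
      (Tendsto p.σ atTop (𝓝 0) →
        Tendsto (fun k => FPDNMT.Theta F (FPDNMT.box l u) (R.X k)) (atTop ⊓ 𝓟 K) (𝓝 0)) := by
  have : NeZero m := ⟨hm.ne'⟩
  have hΩ := FPDNMT.isClosed_box l u
  have hconv := FPDNMT.convex_box l u
  have key : ∀ {ε : ℝ}, 0 < ε → ∀ {N : ℕ}, (∀ k ≥ N, p.σ k ≤ ε) →
      ∃ k ≥ N, -ε ≤ FPDNMT.Theta F (FPDNMT.box l u) (R.X k) := fun hε _ hN =>
    R.exists_neg_le_Theta hF hΩ hconv hα₀ hδ hγ hX0 hX0nd hx₀ hL hfirst hsame hε hN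
  -- Constant positive tolerances do not tend to `0`, so at most one of the two claims has content
  -- and `K` may be chosen separately in each case.
  by_cases hconst : ∃ σ : ℝ, 0 < σ ∧ ∀ k, p.σ k = σ
  · obtain ⟨σ, hσ₀, hσk⟩ := hconst
    have hinf : {k | -σ ≤ FPDNMT.Theta F (FPDNMT.box l u) (R.X k)}.Infinite := by
      refine Set.infinite_of_forall_exists_gt fun N => ?_
      obtain ⟨k, hk, hΘ⟩ := key hσ₀ (N := N + 1) fun k _ => (hσk k).le
      exact ⟨k, hΘ, hk⟩
    refine ⟨_, hinf, fun σ' _ hσ' => ?_, fun htend => ?_⟩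
    · obtain rfl : σ = σ' := (hσk 0).symm.trans (hσ' 0)
      obtain ⟨k, hk⟩ := hinf.nonempty
      exact ⟨k, hk, fun _ hj _ => hj⟩
    · have : Tendsto p.σ atTop (𝓝 σ) := by
        rw [funext hσk]
        exact tendsto_const_nhds
      exact absurd (tendsto_nhds_unique this htend) hσ₀.ne'
  · by_cases htend : Tendsto p.σ atTop (𝓝 0)
    · have hfreq : ∀ i : ℕ, ∃ᶠ k in atTop,
          -(1 / ((i : ℝ) + 1)) ≤ FPDNMT.Theta F (FPDNMT.box l u) (R.X k) := by
        intro i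
        have hi : 0 < 1 / ((i : ℝ) + 1) := by positivity
        obtain ⟨N₀, hN₀⟩ := eventually_atTop.1 (htend.eventually_le_const hi)
        refine frequently_atTop.2 fun N => ?_
        obtain ⟨k, hk, hΘ⟩ := key hi (N := max N N₀) fun k hk =>
          hN₀ k ((le_max_right _ _).trans hk)
        exact ⟨k, (le_max_left _ _).trans hk, hΘ⟩
      -- A diagonal subsequence: `Θ(X^{φ(i)}) ≥ -1/(i+1)`. Together with `Θ ≤ 0` this forces
      -- convergence to `0` along its range.
      obtain ⟨φ, hφ, hΘ⟩ := extraction_forall_of_frequently hfreq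
      refine ⟨range φ, infinite_range_of_injective hφ.injective,
        fun σ hσ₀ hσk => absurd ⟨σ, hσ₀, hσk⟩ hconst, fun _ => ?_⟩
      rw [Metric.tendsto_nhds]
      intro ε hε
      obtain ⟨i, hi⟩ := exists_nat_one_div_lt hε
      rw [eventually_inf_principal]
      filter_upwards [eventually_ge_atTop (φ i)]
      rintro _ hk ⟨j, rfl⟩
      have hij : i ≤ j := hφ.le_iff_le.1 hk
      have h₁ := hΘ j
      have h₂ : 1 / ((j : ℝ) + 1) ≤ 1 / ((i : ℝ) + 1) := by gcongr
      have h₃ := FPDNMT.Theta_nonpos F hΩ (S := R.X (φ j)) fun x hx =>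
        FPDNMT.levelSet_subset F _ x₀ (((R.invariant hΩ hconv hα₀ hδ hγ.1 hX0 hX0nd hx₀ hsame
          (φ j)).level) ((R.invariant hΩ hconv hα₀ hδ hγ.1 hX0 hX0nd hx₀ hsame
          (φ j)).X_subset _ le_rfl hx))
      rw [Real.dist_eq, sub_zero, abs_of_nonpos h₃]
      linarith
    · exact ⟨univ, infinite_univ, fun σ hσ₀ hσk => absurd ⟨σ, hσ₀, hσk⟩ hconst,
        fun h => absurd h htend⟩
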